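/- Let $n\ge 2$, $d\ge 1$ and $r\ge 3$ be integers such that $d\le n$ and $n$ divides $dr$. Let $\boldsymbol{e}_1,\dots,\boldsymbol{e}_n$ be the standard basis of $\mathbb{F}_2^n$, with subscripts taken modulo $n$, and for $x\in\mathbb{Z}_r$ let $\varphi_x$ be the automorphism of $\mathbb{F}_2^n$ with $\varphi_x(\boldsymbol{e}_i)=\boldsymbol{e}_{i+dx}$ for all $i$ (well defined because $n\mid dr$). Let $G=\mathbb{F}_2^n\rtimes_\varphi\mathbb{Z}_r$ be the semidirect product with operation $(\boldsymbol{a},x)(\boldsymbol{b},y)=(\boldsymbol{a}+\varphi_x(\boldsymbol{b}),x+y)$, and let the recursive cube of rings $Q_n(d,r)$ be the Cayley graph on $G$ with respect to the connection set $\{(\boldsymbol{0},1),(\boldsymbol{0},r-1),(\boldsymbol{e}_1,0),\dots,(\boldsymbol{e}_d,0)\}$; that is, $(\boldsymbol{a},x)$ is adjacent to $(\boldsymbol{a},x\pm1)$ and to $(\boldsymbol{a}+\boldsymbol{e}_{i+dx},x)$ for $1\le i\le d$. The diameter of a graph is the maximum distance between two of its vertices ($\infty$ if it is disconnected). If $dr=n$,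 then $$\operatorname{diam}(Q_n(d,r))=\begin{cases} n+r, & \text{if } r=3,\\ n+\lfloor 3r/2\rfloor-2, & \text{if } r\ge 4.\end{cases}$$ If $dr\ge 2n$, then $$\operatorname{diam}(Q_n(d,r))=n+\max\{\lfloor r/2\rfloor,\ 2\lceil n/d\rceil-2\}.$$ -/

import Mathlib

namespace RecursiveCube

/-- The vector space `𝔽₂ⁿ`. Coordinates are indexed by residues modulo `n`, so that the subscripts
of the standard basis vectors are automatically taken modulo `n`. -/
abbrev Vec (n : ℕ) : Type := ZMod n → ZMod 2

/-- The standard basis vector `e_i`, with subscript `i` taken modulo `n`. -/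
def basisVec {n : ℕ} (i : ZMod n) : Vec n := Pi.single i 1

/-- The `c`-th power of the cyclic shift `M` of coordinates, acting on (row) vectors of `𝔽₂ⁿ`;
it sends `e_i` to `e_{i + c}`. The additive group `𝔽₂ⁿ` is written multiplicatively. -/
def rotate {n : ℕ} (c : ZMod n) : MulAut (Multiplicative (Vec n)) where
  toFun a := Multiplicative.ofAdd fun j => a.toAdd (j - c)
  invFun a := Multiplicative.ofAdd fun j => a.toAdd (j + c)
  left_inv a := by
    apply Multiplicative.toAdd.injective
    funext j
    simp
  right_inv a := by
    apply Multiplicative.toAdd.injective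
    funext j
    simp
  map_mul' _ _ := rfl

theorem rotate_basisVec {n : ℕ} (c i : ZMod n) :
    rotate c (Multiplicative.ofAdd (basisVec i)) = Multiplicative.ofAdd (basisVec (i + c)) := by
  apply Multiplicative.toAdd.injective
  funext j
  simp [rotate, basisVec, Pi.single_apply, sub_eq_iff_eq_add]

/-- The additive map `x ↦ d * x` from `ℤ/r` to `ℤ/n`, well defined because `n` divides `d * r`. -/
def scale (n d r : ℕ) (h : n ∣ d * r) : ZMod r →+ ZMod n :=
  ZMod.lift r ⟨zmultiplesHom (ZMod n) (d : ZMod n), by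
    have h' : ((d * r : ℕ) : ZMod n) = 0 := (ZMod.natCast_eq_zero_iff _ _).2 h
    push_cast at h'
    simpa [mul_comm] using h'⟩

theorem scale_intCast (n d r : ℕ) (h : n ∣ d * r) (x : ℤ) :
    scale n d r h (x : ZMod r) = (d : ZMod n) * (x : ZMod n) := by
  simp [scale, mul_comm]

/-- The action `φ` of `ℤ/r` on `𝔽₂ⁿ`, `φ_x(a) = a M^{d x}`. -/
def action (n d r : ℕ) (h : n ∣ d * r) :
    Multiplicative (ZMod r) →* MulAut (Multiplicative (Vec n)) where
  toFun x := rotate (scale n d r h x.toAdd)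
  map_one' := by
    refine MulEquiv.ext fun a => Multiplicative.toAdd.injective (funext fun j => ?_)
    simp [rotate]
  map_mul' x y := by
    refine MulEquiv.ext fun a => Multiplicative.toAdd.injective (funext fun j => ?_)
    simp [rotate, sub_sub, MulAut.mul_apply]

/-- The group `𝔽₂ⁿ ⋊ ℤ/r`, with `(a, x) (b, y) = (a + b M^{d x}, x + y)`. -/
abbrev Vertex (n d r : ℕ) (h : n ∣ d * r) : Type :=
  SemidirectProduct (Multiplicative (Vec n)) (Multiplicative (ZMod r)) (action n d r h)

/-- The group element `(a, x)`. -/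
def vertex {n d r : ℕ} {h : n ∣ d * r} (a : Vec n) (x : ZMod r) : Vertex n d r h :=
  ⟨Multiplicative.ofAdd a, Multiplicative.ofAdd x⟩

/-- The connection set `{(0, 1), (0, r - 1), (e_1, 0), …, (e_d, 0)}`. -/
def connectionSet (n d r : ℕ) (h : n ∣ d * r) : Set (Vertex n d r h) :=
  {vertex 0 1, vertex 0 (-1)} ∪
    {g | ∃ i : ℕ, 1 ≤ i ∧ i ≤ d ∧ g = vertex (basisVec (i : ZMod n)) 0}

/-- The recursive cube of rings `Q_n(d, r)`: the Cayley graph of `𝔽₂ⁿ ⋊ ℤ/r` with respect to the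
connection set above. -/
def graph (n d r : ℕ) (h : n ∣ d * r) : SimpleGraph (Vertex n d r h) :=
  SimpleGraph.mulCayley (connectionSet n d r h)

end RecursiveCube

/-! This is a lamplighter problem. A vertex is a lamp configuration with a cursor on the ring `ℤ/r`.
Each step moves the cursor or toggles one of the `d` consecutive lamps in its window, and
neighbouring positions have adjacent windows. Upper bound: `⌈n/d⌉` consecutive positions reach every
lamp, so a straight walk with one turn back costs at most `n` flips plus its moves
(`edist_turn_le`). Lower bound: toggle all lamps from the identity. Lift the cursor to `ℤ`: reaching
`c` while visiting an interval of length `w` takes at least `2w - |c|` moves (`Tour.walk`), and `n ≤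
d(w + 1)` by counting (`Tour.bounds`). The extremal final positions are `0` and `⌊r/2⌋`. -/

namespace RecursiveCube

/-! ### Steps of the graph as moves and flips -/

variable {n d r : ℕ} {h : n ∣ d * r}

/-- Coordinate `j` can be flipped by one step from a vertex at ring position `x`. -/
def Covers (h : n ∣ d * r) (x : ZMod r) (j : ZMod n) : Prop :=
  ∃ i : ℕ, 1 ≤ i ∧ i ≤ d ∧ j = i + scale n d r h x

theorem vertex_mul_vertex (a b : Vec n) (x y : ZMod r) :
    (vertex a x : Vertex n d r h) * vertex b y =
      vertex (fun j => a j + b (j - scale n d r h x)) (x + y) :=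
  rfl

theorem vertex_mul_shift (a : Vec n) (x s : ZMod r) :
    (vertex a x : Vertex n d r h) * vertex 0 s = vertex a (x + s) := by
  rw [vertex_mul_vertex]
  congr 1
  funext j
  simp

theorem vertex_mul_basisVec (a : Vec n) (x : ZMod r) (i : ZMod n) :
    (vertex a x : Vertex n d r h) * vertex (basisVec i) 0 =
      vertex (a + basisVec (i + scale n d r h x)) x := by
  rw [vertex_mul_vertex, add_zero]
  congr 1
  funext j
  simp [basisVec, Pi.single_apply, sub_eq_iff_eq_add]

theorem add_basisVec_self (a : Vec n) (j : ZMod n) : (a + basisVec j) j = a j + 1 := by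
  simp [basisVec]

theorem add_basisVec_of_ne (a : Vec n) {i j : ZMod n} (hij : i ≠ j) :
    (a + basisVec j) i = a i := by
  simp [basisVec, hij]

theorem exists_eq_vertex (u : Vertex n d r h) : ∃ a x, u = vertex a x :=
  ⟨u.left.toAdd, u.right.toAdd, rfl⟩

theorem vertex_inj {a b : Vec n} {x y : ZMod r} :
    (vertex a x : Vertex n d r h) = vertex b y ↔ a = b ∧ x = y := by
  simp [vertex, SemidirectProduct.ext_iff]

theorem edist_mul_le_one (u g : Vertex n d r h) (hg : g ∈ connectionSet n d r h) :
    (graph n d r h).edist u (u * g) ≤ 1 := by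
  rw [SimpleGraph.edist_le_one_iff_adj_or_eq]
  by_cases hu : u = u * g
  · exact Or.inr hu
  · exact Or.inl ((SimpleGraph.mulCayley_adj' _ _ _).2 ⟨hu, g, hg, Or.inl rfl⟩)

theorem edist_shift_le_one (a : Vec n) (x : ZMod r) {s : ZMod r} (hs : s = 1 ∨ s = -1) :
    (graph n d r h).edist (vertex a x) (vertex a (x + s)) ≤ 1 := by
  rw [← vertex_mul_shift]
  apply edist_mul_le_one
  rcases hs with rfl | rfl
  · exact Or.inl (Or.inl rfl)
  · exact Or.inl (Or.inr rfl)

theorem edist_flip_le_one (a : Vec n) (x : ZMod r) {j : ZMod n} (hj : Covers h x j) :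
    (graph n d r h).edist (vertex a x) (vertex (a + basisVec j) x) ≤ 1 := by
  obtain ⟨i, h1, h2, rfl⟩ := hj
  rw [← vertex_mul_basisVec]
  exact edist_mul_le_one _ _ (Or.inr ⟨i, h1, h2, rfl⟩)

/-- A step of the graph is a move along the ring or a flip of a covered coordinate. -/
theorem adj_cases {a b : Vec n} {x y : ZMod r}
    (hadj : (graph n d r h).Adj (vertex a x) (vertex b y)) :
    (a = b ∧ (y = x + 1 ∨ y = x - 1)) ∨ (x = y ∧ ∃ j, Covers h x j ∧ b = a + basisVec j) := by
  obtain ⟨-, g, hg, hor⟩ := (SimpleGraph.mulCayley_adj' _ _ _).1 hadj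
  rcases hg with (rfl | rfl) | ⟨i, h1, h2, rfl⟩
  · rcases hor with hor | hor <;> rw [vertex_mul_shift, vertex_inj] at hor <;>
      obtain ⟨rfl, rfl⟩ := hor <;> simp
  · rcases hor with hor | hor <;> rw [vertex_mul_shift, vertex_inj] at hor <;>
      obtain ⟨rfl, rfl⟩ := hor <;> simp [sub_eq_add_neg]
  · right
    rcases hor with hor | hor <;> rw [vertex_mul_basisVec, vertex_inj] at hor <;>
      obtain ⟨rfl, rfl⟩ := hor
    · exact ⟨rfl, _, ⟨i, h1, h2, rfl⟩, rfl⟩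
    · exact ⟨rfl, _, ⟨i, h1, h2, rfl⟩, by rw [add_assoc, CharTwo.add_self_eq_zero, add_zero]⟩

/-! ### Upper bounds: explicit walks -/

section Upper

variable [NeZero n]

theorem hammingDist_add_basisVec {a b : Vec n} {j : ZMod n} (hj : a j ≠ b j) :
    hammingDist (a + basisVec j) b + 1 = hammingDist a b := by
  have hflip : ∀ s t : ZMod 2, s ≠ t → s + 1 = t := by decide
  have : ({i | a i ≠ b i} : Finset (ZMod n)) =
      insert j ({i | (a + basisVec j) i ≠ b i} : Finset (ZMod n)) := by
    ext i
    by_cases hij : i = j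
    · subst hij
      simp [hj]
    · simp [-Pi.add_apply, add_basisVec_of_ne _ hij, hij]
  unfold hammingDist
  rw [this, Finset.card_insert_of_notMem]
  simp [-Pi.add_apply, add_basisVec_self, hflip _ _ hj]

/-- If two vectors differ only in coordinates flippable along a straight stretch of the ring, the
stretch can be walked while correcting them. -/
theorem edist_straight_le {s : ZMod r} (hs : s = 1 ∨ s = -1) (m : ℕ) (a b : Vec n) (x : ZMod r)
    (hcov : ∀ j, a j ≠ b j → ∃ i ≤ m, Covers h (x + i * s) j) :
    (graph n d r h).edist (vertex a x) (vertex b (x + m * s)) ≤ (hammingDist a b + m : ℕ) := by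
  obtain ⟨k, hk⟩ : ∃ k, hammingDist a b + m = k := ⟨_, rfl⟩
  rw [hk]
  induction k generalizing a x m with
  | zero =>
    obtain ⟨h0, rfl⟩ : hammingDist a b = 0 ∧ m = 0 := by omega
    rw [hammingDist_eq_zero] at h0
    simp [h0]
  | succ k ih =>
    -- Greedy choice: fix any wrong coordinate in the current window, and move on only when none
    -- remains.
    by_cases hj : ∃ j, a j ≠ b j ∧ Covers h x j
    · obtain ⟨j, hne, hj⟩ := hj
      have hdist := hammingDist_add_basisVec hne
      have hflip := ih m (a + basisVec j) x ?_ (by omega)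
      · calc _ ≤ _ := SimpleGraph.edist_triangle
          _ ≤ _ := add_le_add (edist_flip_le_one a x hj) hflip
          _ = _ := by push_cast; ring
      · intro i hi
        by_cases hij : i = j
        · subst hij
          exact hcov i hne
        · exact hcov i (by simpa [basisVec, hij] using hi)
    · push Not at hj
      cases m with
      | zero =>
        have hab : a = b := by
          funext j
          by_contra hne
          obtain ⟨i, hi, hc⟩ := hcov j hne
          obtain rfl : i = 0 := by omega
          exact hj j hne (by simpa using hc)
        simp [hab]
      | succ m =>
        have hstep := ih m a (x + s) ?_ (by omega)
        · rw [show x + s + m * s = x + ((m + 1 : ℕ) : ZMod r) * s by push_cast; ring] at hstep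
          calc _ ≤ _ := SimpleGraph.edist_triangle
            _ ≤ _ := add_le_add (edist_shift_le_one a x hs) hstep
            _ = _ := by push_cast; ring
        · intro j hne
          obtain ⟨i, hi, hc⟩ := hcov j hne
          cases i with
          | zero => exact absurd (by simpa using hc) (hj j hne)
          | succ i =>
            refine ⟨i, by omega, ?_⟩
            convert hc using 1
            push_cast
            ring

/-- Consecutive windows tile the coordinates: dividing the offset of `j` by `d` gives the position
as quotient and the place in the window as remainder, plus one since windows start at `e_1`. -/
theorem exists_covers {q : ℕ} (hd : 1 ≤ d) (hq : n ≤ d * q) (z : ZMod r) (j : ZMod n) :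
    ∃ i < q, Covers h (z + i) j := by
  set v := (j - 1 - scale n d r h z).val with hv
  have hvn : v < n := ZMod.val_lt _
  refine ⟨v / d, Nat.div_lt_of_lt_mul (by omega), v % d + 1, by omega, Nat.mod_lt _ hd, ?_⟩
  have hscale : scale n d r h ((v / d : ℕ) : ZMod r) = ((d * (v / d) : ℕ) : ZMod n) := by
    have := scale_intCast n d r h ((v / d : ℕ) : ℤ)
    rwa [Int.cast_natCast, Int.cast_natCast, ← Nat.cast_mul] at this
  have hcast : ((v % d + d * (v / d) : ℕ) : ZMod n) = j - 1 - scale n d r h z := by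
    rw [Nat.mod_add_div, hv, ZMod.natCast_zmod_val]
  rw [map_add, hscale]
  push_cast at hcast ⊢
  linear_combination -hcast

theorem exists_covers_straight {s : ZMod r} (hs : s = 1 ∨ s = -1) {m : ℕ} (hd : 1 ≤ d)
    (hm : n ≤ d * (m + 1)) (x : ZMod r) (j : ZMod n) :
    ∃ i ≤ m, Covers h (x + i * s) j := by
  rcases hs with rfl | rfl
  · obtain ⟨i, hi, hc⟩ := exists_covers (h := h) hd hm x j
    exact ⟨i, by omega, by simpa using hc⟩
  -- A backward stretch is a forward one from its far end, read in reverse.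
  · obtain ⟨i, hi, hc⟩ := exists_covers (h := h) hd hm (x - m) j
    refine ⟨m - i, by omega, ?_⟩
    convert hc using 1
    rw [Nat.cast_sub (by omega)]
    ring

/-- Walk `m` steps in one direction, far enough to flip every coordinate, then `l` steps back. -/
theorem edist_turn_le {s : ZMod r} (hs : s = 1 ∨ s = -1) {m : ℕ} (l : ℕ) (hd : 1 ≤ d)
    (hm : n ≤ d * (m + 1)) (a b : Vec n) (x : ZMod r) :
    (graph n d r h).edist (vertex a x) (vertex b (x + m * s - l * s)) ≤ (n + m + l : ℕ) := by
  have h1 := edist_straight_le (h := h) hs m a b x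
    fun j _ => exists_covers_straight hs hd hm x j
  have h2 := edist_straight_le (h := h) (s := -s) (by rcases hs with rfl | rfl <;> simp) l b b
    (x + m * s) (by simp)
  have h3 : hammingDist a b ≤ n := hammingDist_le_card_fintype.trans (ZMod.card n).le
  rw [hammingDist_self, zero_add, mul_neg, ← sub_eq_add_neg] at h2
  calc _ ≤ _ := SimpleGraph.edist_triangle
    _ ≤ _ := add_le_add h1 h2
    _ ≤ _ := by norm_cast; omega

theorem exists_eq_add_mul [NeZero r] (x y : ZMod r) :
    ∃ s : ZMod r, (s = 1 ∨ s = -1) ∧ ∃ k ≤ r / 2, y = x + (k : ℕ) * s := by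
  have hlt := ZMod.val_lt (y - x)
  have hval : (((y - x).val : ℕ) : ZMod r) = y - x := ZMod.natCast_zmod_val _
  rcases le_or_gt (y - x).val (r / 2) with hle | hgt
  · exact ⟨1, Or.inl rfl, _, hle, by rw [hval]; ring⟩
  · refine ⟨-1, Or.inr rfl, r - (y - x).val, by omega, ?_⟩
    rw [Nat.cast_sub hlt.le, hval, ZMod.natCast_self]
    ring

end Upper

/-! ### Lower bounds: lifting walks to `ℤ` -/

section Lower

variable [NeZero n]

/-- A lower bound for the cost `l` of reaching `(b, x)` from the identity: lifting the ring to `ℤ`,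
the positions visited form an interval `[lo, hi]` containing `0` and the final position `c`, and
visiting them takes at least `2 (hi - lo) - |c|` moves. -/
def Tour (h : n ∣ d * r) (b : Vec n) (x : ZMod r) (l : ℕ) : Prop :=
  ∃ lo hi c : ℤ, lo ≤ 0 ∧ 0 ≤ hi ∧ lo ≤ c ∧ c ≤ hi ∧ (c : ZMod r) = x ∧
    (∀ j, b j ≠ 0 → ∃ z : ℤ, lo ≤ z ∧ z ≤ hi ∧ Covers h z j) ∧
    2 * (hi - lo) - c.natAbs + hammingNorm b ≤ l

theorem tour_zero : Tour h 0 0 0 :=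
  ⟨0, 0, 0, by simp [hammingNorm_zero]⟩

/-- A move inside the interval changes `|c|` by one. A move that extends it adds 2 to `2 (hi - lo)`,
but also 1 to `|c|`, as it leads away from `0`. -/
theorem Tour.shift {b : Vec n} {x y : ZMod r} {l : ℕ} (ht : Tour h b x l)
    (hy : y = x + 1 ∨ y = x - 1) : Tour h b y (l + 1) := by
  obtain ⟨lo, hi, c, h1, h2, h3, h4, rfl, hcov, hcost⟩ := ht
  rcases hy with rfl | rfl
  · refine ⟨lo, max hi (c + 1), c + 1, h1, by omega, by omega, by omega, by push_cast; rfl, ?_, ?_⟩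
    · intro j hj
      obtain ⟨z, hz1, hz2, hz⟩ := hcov j hj
      exact ⟨z, hz1, by omega, hz⟩
    · omega
  · refine ⟨min lo (c - 1), hi, c - 1, by omega, h2, by omega, by omega, by push_cast; rfl, ?_, ?_⟩
    · intro j hj
      obtain ⟨z, hz1, hz2, hz⟩ := hcov j hj
      exact ⟨z, by omega, hz2, hz⟩
    · omega

theorem hammingNorm_add_basisVec_le (b : Vec n) (j : ZMod n) :
    hammingNorm (b + basisVec j) ≤ hammingNorm b + 1 := by
  unfold hammingNorm
  refine le_trans (Finset.card_le_card ?_) (Finset.card_insert_le j _)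
  intro i
  by_cases hij : i = j
  · simp [hij]
  · simp [-Pi.add_apply, add_basisVec_of_ne _ hij, hij]

theorem Tour.flip {b : Vec n} {x : ZMod r} {l : ℕ} (ht : Tour h b x l) {j : ZMod n}
    (hj : Covers h x j) : Tour h (b + basisVec j) x (l + 1) := by
  obtain ⟨lo, hi, c, h1, h2, h3, h4, rfl, hcov, hcost⟩ := ht
  refine ⟨lo, hi, c, h1, h2, h3, h4, rfl, ?_, ?_⟩
  · intro i hi'
    by_cases hij : i = j
    · subst hij
      exact ⟨c, h3, h4, hj⟩
    · exact hcov i (by simpa [basisVec, hij] using hi')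
  · have := hammingNorm_add_basisVec_le b j
    omega

theorem Tour.walk {u v : Vertex n d r h} (p : (graph n d r h).Walk u v) {l : ℕ}
    (ht : Tour h u.left.toAdd u.right.toAdd l) :
    Tour h v.left.toAdd v.right.toAdd (l + p.length) := by
  induction p generalizing l with
  | nil => simpa using ht
  | @cons u w v hadj p ih =>
    have hw : Tour h w.left.toAdd w.right.toAdd (l + 1) := by
      obtain ⟨a, x, rfl⟩ := exists_eq_vertex u
      obtain ⟨b, y, rfl⟩ := exists_eq_vertex w
      rcases adj_cases hadj with ⟨rfl, hy⟩ | ⟨rfl, j, hj, rfl⟩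
      · exact Tour.shift ht hy
      · exact Tour.flip ht hj
    have := ih hw
    rwa [SimpleGraph.Walk.length_cons, add_comm p.length, ← add_assoc]

theorem le_edist_of_tour {b : Vec n} {x : ZMod r} {k : ℕ} (hk : ∀ l, Tour h b x l → k ≤ l) :
    (k : ℕ∞) ≤ (graph n d r h).edist (vertex 0 0) (vertex b x) := by
  refine le_iInf fun p => ?_
  have := hk _ (Tour.walk p tour_zero)
  rw [zero_add] at this
  exact_mod_cast this

/-- Flipping all coordinates requires visiting enough positions of the ring. -/
theorem Tour.bounds {x : ZMod r} {l : ℕ} (ht : Tour h (1 : Vec n) x l) :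
    ∃ w c : ℤ, 0 ≤ w ∧ (n : ℤ) ≤ d * (w + 1) ∧ (c.natAbs : ℤ) ≤ w ∧ (c : ZMod r) = x ∧
      2 * w - c.natAbs + n ≤ l := by
  obtain ⟨lo, hi, c, h1, h2, h3, h4, hx, hcov, hcost⟩ := ht
  have hnorm : hammingNorm (1 : Vec n) = n := by simp [hammingNorm]
  rw [hnorm] at hcost
  refine ⟨hi - lo, c, by omega, ?_, by omega, hx, hcost⟩
  -- Each of the `hi - lo + 1` positions covers at most `d` coordinates.
  have hsub : (Finset.univ : Finset (ZMod n)) ⊆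
      (Finset.Icc lo hi ×ˢ Finset.Icc 1 d).image
        fun p => ((p.2 : ℕ) : ZMod n) + scale n d r h (p.1 : ZMod r) := by
    intro j _
    obtain ⟨z, hz1, hz2, i, hi1, hi2, rfl⟩ := hcov j (by simp)
    exact Finset.mem_image.2 ⟨(z, i), by simp [*], rfl⟩
  have hcard := (Finset.card_le_card hsub).trans Finset.card_image_le
  rw [Finset.card_univ, ZMod.card, Finset.card_product, Int.card_Icc, Nat.card_Icc,
    Nat.add_sub_cancel, mul_comm] at hcard
  calc (n : ℤ) ≤ ((d * (hi + 1 - lo).toNat : ℕ) : ℤ) := by exact_mod_cast hcard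
    _ = d * (hi - lo + 1) := by
      rw [Nat.cast_mul, Int.toNat_of_nonneg (by omega)]
      ring

theorem exists_eq_add_mul_of_intCast_eq {c : ℤ} {k : ℕ} (hc : (c : ZMod r) = k) :
    ∃ t : ℤ, c = k + r * t := by
  have : (c : ZMod r) = ((k : ℤ) : ZMod r) := by simpa using hc
  rw [ZMod.intCast_eq_intCast_iff_dvd_sub, ← dvd_neg] at this
  obtain ⟨t, ht⟩ := this
  exact ⟨t, by linarith⟩

theorem le_natAbs_add_mul {k : ℕ} (hk : k ≤ r / 2) {t : ℤ} : k ≤ ((k : ℤ) + r * t).natAbs := by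
  rcases lt_trichotomy t 0 with ht | rfl | ht
  · have : (r : ℤ) * t ≤ r * (-1) := by gcongr; omega
    omega
  · simp
  · have : (r : ℤ) * 1 ≤ r * t := by gcongr; omega
    omega

theorem le_ediam_of_tour {x : ZMod r} {k : ℕ} (hk : ∀ l, Tour h (1 : Vec n) x l → k ≤ l) :
    (k : ℕ∞) ≤ (graph n d r h).ediam :=
  (le_edist_of_tour hk).trans SimpleGraph.edist_le_ediam

end Lower

/-! ### The two diameter formulas -/

section Diameter

theorem ediam_le_iff_vertex {k : ℕ∞} :
    (graph n d r h).ediam ≤ k ↔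
      ∀ a x b y, (graph n d r h).edist (vertex a x) (vertex b y) ≤ k := by
  rw [SimpleGraph.ediam_le_iff]
  exact ⟨fun H a x b y => H _ _,
    fun H u v => H u.left.toAdd u.right.toAdd v.left.toAdd v.right.toAdd⟩

variable [NeZero n]

theorem ediam_of_mul_eq (hd : 1 ≤ d) (hr : 3 ≤ r) (hdr : d * r = n) :
    (graph n d r h).ediam = ((n + max r (r + r / 2 - 2) : ℕ) : ℕ∞) := by
  have : NeZero r := ⟨by omega⟩
  have hcov : n ≤ d * (r - 1 + 1) := by rw [Nat.sub_add_cancel (by omega), hdr]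
  have hr0 : ((r - 1 : ℕ) : ZMod r) = -1 := by
    rw [Nat.cast_sub (by omega), ZMod.natCast_self]
    simp
  apply le_antisymm
  · rw [ediam_le_iff_vertex]
    intro a x b y
    obtain ⟨s, hs, k, hk, rfl⟩ := exists_eq_add_mul x y
    -- If the cursor must return to its start, a full turn costs `r`. Otherwise go `r - 1` steps the
    -- long way, past the target, and then back `k`.
    cases k with
    | zero =>
      have := edist_turn_le (h := h) (s := s) (m := r) hs 0 hd (by rw [mul_add, hdr]; omega) a b x
      simp only [ZMod.natCast_self, Nat.cast_zero, zero_mul, sub_zero] at this ⊢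
      exact this.trans (by norm_cast; omega)
    | succ k =>
      have := edist_turn_le (h := h) (s := -s) (by rcases hs with rfl | rfl <;> simp)
        k hd hcov a b x
      rw [hr0, show x + -1 * -s - k * -s = x + ((k + 1 : ℕ) : ZMod r) * s by push_cast; ring] at this
      exact this.trans (by norm_cast; omega)
  · have key : ∀ {x : ZMod r} {l : ℕ}, Tour h (1 : Vec n) x l →
        ∃ w c : ℤ, (r : ℤ) ≤ w + 1 ∧ (c.natAbs : ℤ) ≤ w ∧ (c : ZMod r) = x ∧ 2 * w - c.natAbs + n ≤ l := by
      intro x l ht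
      obtain ⟨w, c, -, h1, h2, h3, h4⟩ := ht.bounds
      refine ⟨w, c, ?_, h2, h3, h4⟩
      rw [← hdr] at h1
      push_cast at h1
      exact le_of_mul_le_mul_left h1 (by exact_mod_cast hd)
    rcases le_total r (r + r / 2 - 2) with hle | hle
    · rw [max_eq_right hle]
      refine le_ediam_of_tour (x := ((r / 2 : ℕ) : ZMod r)) fun l ht => ?_
      obtain ⟨w, c, h1, h2, h3, h4⟩ := key ht
      obtain ⟨t, rfl⟩ := exists_eq_add_mul_of_intCast_eq h3
      -- If `|c|` is small, `w ≥ r - 1` makes `2w - |c|` large; otherwise `w ≥ |c|` does.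
      have hab : (((r / 2 : ℕ) : ℤ) + r * t).natAbs ≤ r - r / 2 ∨
          r + r / 2 ≤ (((r / 2 : ℕ) : ℤ) + r * t).natAbs := by
        rcases lt_trichotomy t 0 with ht | rfl | ht
        · rcases (show t ≤ -1 by omega).eq_or_lt with rfl | ht
          · left
            omega
          · have : (r : ℤ) * t ≤ r * (-2) := by gcongr; omega
            right
            omega
        · left
          omega
        · have : (r : ℤ) * 1 ≤ r * t := by gcongr; omega
          right
          omega
      omega
    · rw [max_eq_left hle]
      refine le_ediam_of_tour (x := ((0 : ℕ) : ZMod r)) fun l ht => ?_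
      obtain ⟨w, c, h1, h2, h3, h4⟩ := key ht
      obtain ⟨t, rfl⟩ := exists_eq_add_mul_of_intCast_eq h3
      rcases lt_trichotomy t 0 with ht | rfl | ht
      · have : (r : ℤ) * t ≤ r * (-1) := by gcongr; omega
        omega
      · simp at *
        omega
      · have : (r : ℤ) * 1 ≤ r * t := by gcongr; omega
        omega

/-- Here `q` is `⌈n/d⌉`, given by its universal property. Since `2q - 2 ≤ r`, going around the ring
never beats going out `q - 1` steps and back. -/
theorem ediam_of_two_mul_le {q : ℕ} (hd : 1 ≤ d) (hr : 3 ≤ r) (hdr : 2 * n ≤ d * r)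
    (hq : ∀ m, q ≤ m ↔ n ≤ d * m) :
    (graph n d r h).ediam = ((n + max (r / 2) (2 * q - 2) : ℕ) : ℕ∞) := by
  have : NeZero r := ⟨by omega⟩
  have hq1 : 1 ≤ q := by
    by_contra h0
    have := (hq 0).1 (by omega)
    have := NeZero.pos n
    omega
  have hqr : 2 * q - 2 ≤ r := by
    by_contra! hlt
    have h1 : ¬ n ≤ d * (q - 1) := fun hle => by
      have := (hq _).2 hle
      omega
    have h2 : d * r ≤ d * (2 * (q - 1)) := by gcongr; omega
    rw [mul_left_comm] at h2
    omega
  apply le_antisymm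
  · rw [ediam_le_iff_vertex]
    intro a x b y
    obtain ⟨s, hs, k, hk, rfl⟩ := exists_eq_add_mul x y
    -- Overshoot the target if needed to cover everything: the moves number `max k (2(q - 1) - k)`.
    have := edist_turn_le (h := h) (m := max k (q - 1)) hs (max k (q - 1) - k) hd
      ((hq _).1 (by omega)) a b x
    rw [Nat.cast_sub (by omega), show ∀ M K : ZMod r, x + M * s - (M - K) * s = x + K * s by
      intros; ring] at this
    exact this.trans (by norm_cast; omega)
  · rcases le_total (2 * q - 2) (r / 2) with hle | hle
    · rw [max_eq_left hle]
      refine le_ediam_of_tour (x := ((r / 2 : ℕ) : ZMod r)) fun l ht => ?_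
      obtain ⟨w, c, -, h1, h2, h3, h4⟩ := ht.bounds
      obtain ⟨t, rfl⟩ := exists_eq_add_mul_of_intCast_eq h3
      have := le_natAbs_add_mul le_rfl (r := r) (t := t)
      omega
    · rw [max_eq_right hle]
      refine le_ediam_of_tour (x := ((0 : ℕ) : ZMod r)) fun l ht => ?_
      obtain ⟨w, c, h0, h1, h2, h3, h4⟩ := ht.bounds
      have hw : (q : ℤ) ≤ w + 1 := by
        lift w to ℕ using h0
        exact_mod_cast (hq (w + 1)).2 (by exact_mod_cast h1)
      obtain ⟨t, rfl⟩ := exists_eq_add_mul_of_intCast_eq h3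
      rcases lt_trichotomy t 0 with ht | rfl | ht
      · have : (r : ℤ) * t ≤ r * (-1) := by gcongr; omega
        omega
      · simp at *
        omega
      · have : (r : ℤ) * 1 ≤ r * t := by gcongr; omega
        omega

end Diameter

end RecursiveCube

theorem theorem4p1 (n d r : ℕ) (hn : 2 ≤ n) (hd : 1 ≤ d) (hdn : d ≤ n) (hr : 3 ≤ r)
    (hdr : n ∣ d * r) :
    (d * r = n →
      (r = 3 → (RecursiveCube.graph n d r hdr).ediam = ((n + r : ℕ) : ℕ∞)) ∧
      (4 ≤ r → (RecursiveCube.graph n d r hdr).ediam = ((n + 3 * r / 2 - 2 : ℕ) : ℕ∞))) ∧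
    (2 * n ≤ d * r →
      (RecursiveCube.graph n d r hdr).ediam =
        ((n + max (r / 2) (2 * ⌈(n : ℚ) / (d : ℚ)⌉₊ - 2) : ℕ) : ℕ∞)) := by
 
  have : NeZero n := ⟨by omega⟩
  refine ⟨fun heq => ⟨fun h3 => ?_, fun h4 => ?_⟩, fun hle => ?_⟩
  · rw [RecursiveCube.ediam_of_mul_eq hd hr heq]
    congr 1
    omega
  · rw [RecursiveCube.ediam_of_mul_eq hd hr heq]
    congr 1
    omega
  · refine RecursiveCube.ediam_of_two_mul_le hd hr hle fun m => ?_
    rw [Nat.ceil_le, div_le_iff₀ (by exact_mod_cast hd), mul_comm]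
    exact_mod_cast Iff.rfl
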